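/- Let $G$ be a finite group acting on finite sets $X$ and $Y$, with $Y\neq\emptyset$, and let $\mathbb R^X,\mathbb R^Y$ be the permutation representations ($g\,e_x=e_{gx}$). Let $G$ act trivially on $\mathbb R$, and let $\sigma:\mathbb R\to\mathbb R$ be continuous and not a polynomial; $\sigma$ is applied coordinatewise to vectors. For representations $V,W$ of $G$, a *layer space* is a set $\{v\mapsto\varphi(v)+w \mid \varphi\in L,\ w\in W^G\}$ of affine maps $V\to W$, where $L$ is a linear subspace of $\mathrm{Hom}_G(V,W)$ and $W^G$ is the space of fixed vectors (for $W=\mathbb R^Y$, the span of the indicators of the orbits of $Y$); $L$ is its *linear part*. Let $M$ be a layer space from $\mathbb R^X$ to $\mathbb R^Y$ and $N$ a layer space from $\mathbb R^Y$ to $\mathbb R$, such that * the linear part of $M$ is compatible with the orbit decomposition of $Y$: if $\varphi$ belongs to it and $O\subseteq Y$ is an orbit, then so does the map obtained from $\varphi$ by setting the coordinates outside $O$ to $0$ (automatic if $Y$ is a single orbit, or if $M=\mathrm{Aff}_G(\mathbb R^X,\mathbb R^Y)$, the space of all $G$-equivariant affine maps); * for each orbit $O\subseteq Y$ some element $\psi$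 of the linear part of $N$ satisfies $\psi(\mathbf 1_O)\ne0$ (for instance, when $v\mapsto\sum_{i\in Y}v_i$ is in the linear part of $N$). For $h\in\mathbb N$ let $M_h=\{x\mapsto(f_1(x),\dots,f_h(x)) \mid f_k\in M\}$ and ${}_hN=\{(x_1,\dots,x_h)\mapsto g_1(x_1)+\dots+g_h(x_h)\mid g_k\in N\}$, and let the *universality class* $\mathcal U(M,N)$ be the closure of $$\bigcup_{h\in\mathbb N}\{\beta\circ\sigma\circ\alpha\mid \alpha\in M_h,\ \beta\in{}_hN\}$$ in $\mathcal C(\mathbb R^X,\mathbb R)$ with the topology of uniform convergence on compact sets. Let $\phi^1,\dots,\phi^m$ be any basis of the linear part of $M$, and for $i\in Y$ let $\phi_i:\mathbb R^X\to\mathbb R^m$, $\phi_i(x)=(\phi^1_i(x),\dots,\phi^m_i(x))$, be the associated basis maps. Then $$\mathcal U(M,N)=\overline{\Delta},\qquad \Delta=\Big\{x\mapsto\sum_{i\in Y}f(\phi_i(x)) \;\Big|\; f\in\mathcal C(\mathbb R^m,\mathbb R)\Big\},$$ where the closure is taken in the same topology. -/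

import Mathlib

noncomputable section

namespace InvNet

/-- The permutation representation of `G` on `ℝ^X`: the linear action with `g e_x = e_{g x}`,
that is `(g v)(x) = v (g⁻¹ x)`. -/
def permRep (G X : Type*) [Group G] [MulAction G X] : Representation ℝ G (X → ℝ) where
  toFun g := LinearMap.funLeft ℝ ℝ (fun x => g⁻¹ • x)
  map_one' := by
    ext v x
    simp [LinearMap.funLeft]
  map_mul' g h := by
    ext v x
    simp [LinearMap.funLeft, mul_smul]

lemma permRep_apply {G X : Type*} [Group G] [MulAction G X] (g : G) (v : X → ℝ) (x : X) :
    permRep G X g v x = v (g⁻¹ • x) := rfl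

/-- The defining property of the permutation representation on the canonical basis. -/
lemma permRep_single {G X : Type*} [Group G] [MulAction G X] [DecidableEq X] (g : G) (x : X) :
    permRep G X g (Pi.single x 1) = Pi.single (g • x) 1 := by
  ext y
  simp only [permRep_apply, Pi.single_apply, inv_smul_eq_iff]

/-- The fixed vectors of `ℝ^Y` are the linear combinations of the indicators of the orbits. -/
lemma mem_invariants_permRep {G Y : Type*} [Group G] [MulAction G Y] (w : Y → ℝ) :
    w ∈ (permRep G Y).invariants ↔
      ∃ c : MulAction.orbitRel.Quotient G Y → ℝ, ∀ y, w y = c (Quotient.mk _ y) := by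
  rw [Representation.mem_invariants]
  constructor
  · intro h
    refine ⟨Quotient.lift w ?_, fun y => rfl⟩
    rintro a b ⟨g, hg⟩
    have := congrFun (h g) a
    rw [permRep_apply, ← hg] at this
    simpa [← hg] using this.symm
  · rintro ⟨c, hc⟩ g
    ext y
    rw [permRep_apply, hc, hc]
    congr 1
    exact Quotient.sound ⟨g⁻¹, rfl⟩

section layers

variable {G V W : Type*} [Group G] [AddCommGroup V] [Module ℝ V] [AddCommGroup W] [Module ℝ W]

/-- `M` is a layer space of equivariant affine maps `V → W`:
`M = {v ↦ φ v + w | φ ∈ L, w ∈ W^G}` for a linear subspace `L` of `Hom_G(V, W)`. -/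
def IsLayerSpace (ρ : Representation ℝ G V) (τ : Representation ℝ G W)
    (M : Submodule ℝ (V →ᵃ[ℝ] W)) : Prop :=
  ∃ L : Submodule ℝ (V →ₗ[ℝ] W),
    (∀ φ ∈ L, ∀ g v, φ (ρ g v) = τ g (φ v)) ∧
    ∀ f : V →ᵃ[ℝ] W, f ∈ M ↔ ∃ φ ∈ L, ∃ w ∈ τ.invariants, ∀ v, f v = φ v + w

/-- The space `λ(M)` of linear parts of the affine maps in `M`. -/
def linearPart (M : Submodule ℝ (V →ᵃ[ℝ] W)) : Submodule ℝ (V →ₗ[ℝ] W) :=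
  M.map (LinearMap.snd ℝ W (V →ₗ[ℝ] W) ∘ₗ
    (AffineMap.toConstProdLinearMap ℝ : (V →ᵃ[ℝ] W) ≃ₗ[ℝ] W × (V →ₗ[ℝ] W)).toLinearMap)

lemma mem_linearPart (M : Submodule ℝ (V →ᵃ[ℝ] W)) (φ : V →ₗ[ℝ] W) :
    φ ∈ linearPart M ↔ ∃ f ∈ M, f.linear = φ := Iff.rfl

end layers

/-- The projection of `ℝ^Y` onto the coordinates in the orbit of `y`; the other coordinates are
set to zero. -/
def orbitProj (G : Type*) {Y : Type*} [Group G] [MulAction G Y] (y : Y) :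
    (Y → ℝ) →ₗ[ℝ] (Y → ℝ) where
  toFun v := (MulAction.orbit G y).indicator v
  map_add' v w := Set.indicator_add _ v w
  map_smul' c v := Set.indicator_const_smul _ c v

section networks

variable {V Y Z : Type*} [AddCommGroup V] [Module ℝ V] [AddCommGroup Z] [Module ℝ Z]

/-- The point-wise activation on `ℝ^I`. -/
def pointwise {I : Type*} (σ : ℝ → ℝ) (v : I → ℝ) : I → ℝ := fun i => σ (v i)

/-- The neural space of shallow networks `x ↦ φ (σ (η x))` with layers `η ∈ A`, `φ ∈ B`. -/
def neuralSpace {I : Type*} (σ : ℝ → ℝ) (A : Set (V →ᵃ[ℝ] (I → ℝ)))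
    (B : Set ((I → ℝ) →ᵃ[ℝ] Z)) : Set (V → Z) :=
  {F | ∃ η ∈ A, ∃ φ ∈ B, F = fun x => φ (pointwise σ (η x))}

/-- `M_h = {x ↦ (f_1 x, …, f_h x) | f_k ∈ M}`; the hidden space `ℝ^Y ⊗ ℝ^h` is
`ℝ^([h] × Y)`. -/
def widen (M : Submodule ℝ (V →ᵃ[ℝ] (Y → ℝ))) (h : ℕ) : Set (V →ᵃ[ℝ] (Fin h × Y → ℝ)) :=
  {F | ∃ f : Fin h → (V →ᵃ[ℝ] (Y → ℝ)), (∀ k, f k ∈ M) ∧ ∀ x k y, F x (k, y) = f k x y}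

/-- `_hN = {(x_1, …, x_h) ↦ g_1 x_1 + ⋯ + g_h x_h | g_k ∈ N}`. -/
def cowiden (N : Submodule ℝ ((Y → ℝ) →ᵃ[ℝ] Z)) (h : ℕ) : Set ((Fin h × Y → ℝ) →ᵃ[ℝ] Z) :=
  {F | ∃ g : Fin h → ((Y → ℝ) →ᵃ[ℝ] Z), (∀ k, g k ∈ N) ∧
    ∀ v, F v = ∑ k, g k (fun y => v (k, y))}

/-- The universality class `U(M, N)`: the closure in `C(V, Z)`, for uniform convergence on compact
sets (the compact-open topology), of the networks of all widths. -/
def universalityClass [TopologicalSpace V] [TopologicalSpace Z] (σ : ℝ → ℝ)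
    (M : Submodule ℝ (V →ᵃ[ℝ] (Y → ℝ))) (N : Submodule ℝ ((Y → ℝ) →ᵃ[ℝ] Z)) : Set C(V, Z) :=
  closure {F | ∃ h : ℕ, ⇑F ∈ neuralSpace σ (widen M h) (cowiden N h)}

end networks

/-- The basis map `φ_i : x ↦ (φ^1_i(x), …, φ^m_i(x))` of linear maps `φ^1, …, φ^m : V → ℝ^Y`. -/
def basisMap {V Y : Type*} [AddCommGroup V] [Module ℝ V] {m : ℕ}
    (φ : Fin m → (V →ₗ[ℝ] (Y → ℝ))) (i : Y) : V →ₗ[ℝ] (Fin m → ℝ) :=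
  LinearMap.pi fun t => LinearMap.proj i ∘ₗ φ t

/-- The symmetric ridge superpositions `Δ(φ_i)_{i ∈ Y}`. -/
def symmetricSuperpositions {V Y : Type*} [AddCommGroup V] [Module ℝ V] [TopologicalSpace V]
    [Fintype Y] {m : ℕ} (φ : Y → (V →ₗ[ℝ] (Fin m → ℝ))) : Set C(V, ℝ) :=
  {F | ∃ f : C(Fin m → ℝ, ℝ), ∀ x, F x = ∑ i, f (φ i x)}

end InvNet

end

/-! Networks lie in Δ: invariance makes the outer weights and the biases constant on orbits, so each
channel is `∑ i, H_o(i) (φ_i x)`, with an outer function depending on the orbit `o(i)`. As the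
linear part of `M` is stable under orbit projections, linear maps `P o` on `ℝ^m` fix `φ_i x` for `i`
in `o` and kill it otherwise; a sum of terms `H_o (P o z)`, corrected by constants, is a single
outer function (`mem_symmetricSuperpositions_of_orbitwise`).

Conversely, the `f` for which `∑ i, f (φ_i x)` lies in the closure of the networks form a closed
subspace of `C(ℝ^m)`. It contains every ridge function `σ (a · z + b)`, since its superposition
splits into orbit sums, each a network (`sum_orbit_mem_networks`). By `dense_span_ridge` it is
everything.

The ridge theorem reduces to one variable: a closed affine-invariant subspace of `C(ℝ)` containing a
non-polynomial contains all monomials. Otherwise some `t ^ n` is missing; differentiating `g (w * t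
+ b)` `n` times in `w` at `0` then forces smooth members to be polynomials of degree `< n`, and
averaging extends this to all members. -/

open Filter Topology

/-! ### Closed subspaces of `C(X, ℝ)` -/

/-- In the compact-open topology, a function that can be approximated uniformly on every compact
set by elements of `S` belongs to the closure of `S`. -/
lemma ContinuousMap.mem_closure_of_forall_isCompact {X : Type*} [TopologicalSpace X]
    {S : Set C(X, ℝ)} {f : C(X, ℝ)}
    (h : ∀ K : Set X, IsCompact K → ∀ ε > 0, ∃ g ∈ S, ∀ x ∈ K, |g x - f x| < ε) :
    f ∈ closure S := by
  rw [mem_closure_iff_nhds_basis (nhds_basis_uniformity'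
    Metric.uniformity_basis_dist.compactConvergenceUniformity)]
  rintro ⟨K, ε⟩ ⟨hK, hε⟩
  obtain ⟨g, hg, hgf⟩ := h K hK ε hε
  refine ⟨g, hg, fun x hx => ?_⟩
  simpa [dist_comm, Real.dist_eq, abs_sub_comm] using hgf x hx

/-- A subalgebra of `C(X, ℝ)` that separates points is dense in the compact-open topology. -/
lemma Subalgebra.SeparatesPoints.closure_eq_univ {X : Type*} [TopologicalSpace X]
    {A : Subalgebra ℝ C(X, ℝ)} (hA : A.SeparatesPoints) :
    closure (A : Set C(X, ℝ)) = Set.univ :=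
  Set.eq_univ_of_forall fun f => ContinuousMap.mem_closure_of_forall_isCompact fun _ hK _ hε =>
    ContinuousMap.exists_mem_subalgebra_near_continuous_of_isCompact_of_separatesPoints
      hA f hK hε

/-- A closed subspace of `C(X, ℝ)` contains the averages over the unit interval of its continuous
families. -/
lemma Submodule.mem_of_eq_integral {X : Type*} [TopologicalSpace X] {S : Submodule ℝ C(X, ℝ)}
    (hS : IsClosed (S : Set C(X, ℝ))) (F : C(ℝ × X, ℝ)) (hF : ∀ s, F.curry s ∈ S)
    {f : C(X, ℝ)} (hf : ∀ x, f x = ∫ s in (0 : ℝ)..1, F (s, x)) : f ∈ S := by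
  rw [← SetLike.mem_coe, ← hS.closure_eq]
  refine ContinuousMap.mem_closure_of_forall_isCompact fun K hK ε hε => ?_
  have := isCompact_iff_compactSpace.mp hK
  -- `C(K, ℝ)` is a Banach space, so the average exists there as a Bochner integral, and closed
  -- convex sets contain it.
  let r : C(X, ℝ) →ₗ[ℝ] C(K, ℝ) :=
    (ContinuousMap.compRightAlgHom ℝ ℝ
      (⟨Subtype.val, continuous_subtype_val⟩ : C(K, X))).toLinearMap
  have hr : Continuous r := ContinuousMap.continuous_precomp _
  let T : Submodule ℝ C(K, ℝ) := (S.map r).topologicalClosure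
  let μ : MeasureTheory.Measure ℝ := MeasureTheory.volume.restrict (Set.Ioc 0 1)
  have hμ : MeasureTheory.IsProbabilityMeasure μ := ⟨by simp [μ]⟩
  have hcont : Continuous fun s => r (F.curry s) := hr.comp F.curry.continuous
  have hint : MeasureTheory.Integrable (fun s => r (F.curry s)) μ :=
    (hcont.integrableOn_Icc (a := 0) (b := 1)).mono_set Set.Ioc_subset_Icc_self
  have hmem : ∫ s, r (F.curry s) ∂μ ∈ T :=
    T.convex.integral_mem (S.map r).isClosed_topologicalClosure
      (Eventually.of_forall fun s => (S.map r).le_topologicalClosure ⟨_, hF s, rfl⟩) hint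
  have hfr : ∫ s, r (F.curry s) ∂μ = r f := by
    ext x
    have := (ContinuousMap.evalCLM ℝ x).integral_comp_comm hint
    rw [ContinuousMap.evalCLM_apply] at this
    rw [← this]
    change _ = f x
    rw [hf, intervalIntegral.integral_of_le zero_le_one]
    rfl
  rw [hfr] at hmem
  obtain ⟨_, ⟨g, hg, rfl⟩, hgf⟩ := Metric.mem_closure_iff.mp hmem ε hε
  refine ⟨g, hg, fun x hx => ?_⟩
  have := (ContinuousMap.dist_lt_iff hε).mp hgf ⟨x, hx⟩
  rwa [dist_comm, Real.dist_eq] at this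

/-! ### Density in one variable -/

/-- Differentiation with respect to the dilation parameter inside a closed subspace of `C(ℝ)`. -/
lemma Submodule.pow_succ_mul_deriv_mem {S : Submodule ℝ C(ℝ, ℝ)}
    (hS : IsClosed (S : Set C(ℝ, ℝ))) {g : ℝ → ℝ} (hg : Differentiable ℝ g)
    (hg' : Continuous (deriv g)) {k : ℕ}
    (h : ∀ (w b : ℝ) (F : C(ℝ, ℝ)), (∀ t, F t = t ^ k * g (w * t + b)) → F ∈ S)
    (w b : ℝ) (F : C(ℝ, ℝ)) (hF : ∀ t, F t = t ^ (k + 1) * deriv g (w * t + b)) : F ∈ S := by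
  -- For `d ≠ 0` this is the difference quotient in `w` with step `d`; the integral form is jointly
  -- continuous, also at `d = 0`.
  let Q : C(ℝ × ℝ, ℝ) := ⟨fun p => p.2 ^ (k + 1) *
    ∫ u in (0 : ℝ)..1, deriv g (w * p.2 + b + u * (p.1 * p.2)), by fun_prop⟩
  have hQ : ∀ d ∈ ({0}ᶜ : Set ℝ), Q.curry d ∈ S := by
    intro d hd
    have key : Q.curry d = d⁻¹ • ((⟨fun t => t ^ k * g ((w + d) * t + b), by
        have := hg.continuous; fun_prop⟩ : C(ℝ, ℝ)) -
        ⟨fun t => t ^ k * g (w * t + b), by have := hg.continuous; fun_prop⟩) := by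
      ext t
      have hd' : d ≠ 0 := hd
      have hftc : ∫ u in (0 : ℝ)..1, deriv g (w * t + b + u * (d * t)) * (d * t) =
          g (w * t + b + 1 * (d * t)) - g (w * t + b + 0 * (d * t)) := by
        refine intervalIntegral.integral_eq_sub_of_hasDerivAt
          (f := fun u => g (w * t + b + u * (d * t))) (fun u _ => ?_)
          (Continuous.intervalIntegrable (by fun_prop) _ _)
        have h1 : HasDerivAt (fun u : ℝ => w * t + b + u * (d * t)) (d * t) u := by
          simpa using ((hasDerivAt_id u).mul_const (d * t)).const_add (w * t + b)
        exact (hg _).hasDerivAt.comp u h1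
      rw [intervalIntegral.integral_mul_const] at hftc
      simp only [Q, ContinuousMap.curry_apply, ContinuousMap.coe_mk, ContinuousMap.coe_smul,
        ContinuousMap.coe_sub, Pi.smul_apply, Pi.sub_apply, smul_eq_mul]
      rw [show (w + d) * t + b = w * t + b + 1 * (d * t) by ring, ← mul_sub,
        show g (w * t + b) = g (w * t + b + 0 * (d * t)) by simp, ← hftc]
      generalize (∫ u in (0 : ℝ)..1, deriv g (w * t + b + u * (d * t))) = I
      field_simp
      ring
    rw [key]
    exact S.smul_mem _ (S.sub_mem (h _ _ _ fun _ => rfl) (h _ _ _ fun _ => rfl))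
  have h0 : Q.curry 0 ∈ (S : Set C(ℝ, ℝ)) := by
    rw [← hS.closure_eq]
    exact map_mem_closure Q.curry.continuous ((dense_compl_singleton (0 : ℝ)) 0) hQ
  have hF0 : F = Q.curry 0 := by
    ext t
    simp [Q, hF]
  rwa [hF0]

/-- Each derivative in `w` of `g (w * t + b)` brings out a factor `t`. -/
lemma Submodule.pow_mul_iteratedDeriv_mem {S : Submodule ℝ C(ℝ, ℝ)}
    (hS : IsClosed (S : Set C(ℝ, ℝ))) {g : ℝ → ℝ} {n : ℕ} (hg : ContDiff ℝ n g)
    (h : ∀ (w b : ℝ) (F : C(ℝ, ℝ)), (∀ t, F t = g (w * t + b)) → F ∈ S) :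
    ∀ k ≤ n, ∀ (w b : ℝ) (F : C(ℝ, ℝ)),
      (∀ t, F t = t ^ k * iteratedDeriv k g (w * t + b)) → F ∈ S := by
  intro k
  induction k with
  | zero => simpa using h
  | succ k ih =>
    intro hk w b F hF
    rw [iteratedDeriv_succ] at hF
    have hk' : (k : WithTop ℕ∞) < n := by exact_mod_cast hk
    refine S.pow_succ_mul_deriv_mem hS (hg.differentiable_iteratedDeriv k hk') ?_
      (ih (by omega)) w b F hF
    rw [← iteratedDeriv_succ]
    exact hg.continuous_iteratedDeriv (k + 1) (by exact_mod_cast hk)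

lemma Polynomial.exists_derivative_eq_of_mem_degreeLT {n : ℕ} {p : Polynomial ℝ}
    (hp : p ∈ Polynomial.degreeLT ℝ n) :
    ∃ q ∈ Polynomial.degreeLT ℝ (n + 1), q.derivative = p := by
  refine ⟨∑ i ∈ Finset.range n, Polynomial.monomial (i + 1) (p.coeff i / (i + 1)),
    Submodule.sum_mem _ fun i hi => ?_, ?_⟩
  · rw [Polynomial.mem_degreeLT]
    refine (Polynomial.degree_monomial_le _ _).trans_lt ?_
    exact_mod_cast Nat.succ_lt_succ (Finset.mem_range.mp hi)
  · ext k
    simp only [Polynomial.coeff_derivative, Polynomial.finsetSum_coeff, Polynomial.coeff_monomial,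
      add_left_inj, Finset.sum_ite_eq', Finset.mem_range]
    split_ifs with hk
    · field_simp
    · rw [Polynomial.mem_degreeLT] at hp
      rw [zero_mul, Polynomial.coeff_eq_zero_of_degree_lt
        (hp.trans_le (by exact_mod_cast not_lt.mp hk))]

/-- A function of class `C^n` with vanishing `n`-th derivative is a polynomial of degree `< n`. -/
lemma exists_polynomial_of_iteratedDeriv_eq_zero {n : ℕ} {g : ℝ → ℝ} (hg : ContDiff ℝ n g)
    (h : ∀ t, iteratedDeriv n g t = 0) :
    ∃ p ∈ Polynomial.degreeLT ℝ n, ∀ t, g t = p.eval t := by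
  induction n generalizing g with
  | zero => exact ⟨0, Submodule.zero_mem _, by simpa using h⟩
  | succ n ih =>
    have hg1 : ContDiff ℝ (n + 1) g := by exact_mod_cast hg
    obtain ⟨hd, -, hg'⟩ := contDiff_succ_iff_deriv.mp hg1
    obtain ⟨p, hp, hgp⟩ := ih hg' fun t => by rw [← iteratedDeriv_succ']; exact h t
    obtain ⟨q, hq, rfl⟩ := Polynomial.exists_derivative_eq_of_mem_degreeLT hp
    have hc : ∀ t, g t - q.eval t = g 0 - q.eval 0 := fun t =>
      is_const_of_deriv_eq_zero (f := fun t => g t - q.eval t) (hd.sub q.differentiable)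
        (fun x => by
          rw [deriv_fun_sub (hd x) q.differentiableAt, hgp, Polynomial.deriv, sub_self]) t 0
    refine ⟨q + Polynomial.C (g 0 - q.eval 0), Submodule.add_mem _ hq ?_, fun t => ?_⟩
    · rw [Polynomial.mem_degreeLT]
      exact Polynomial.degree_C_le.trans_lt (by exact_mod_cast n.succ_pos)
    · rw [Polynomial.eval_add, Polynomial.eval_C, ← hc t]
      ring

/-- Polynomials of bounded degree are closed under pointwise limits. -/
lemma exists_polynomial_of_tendsto {n : ℕ} {u : ℕ → ℝ → ℝ} {g : ℝ → ℝ}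
    (hu : ∀ j, ∃ p ∈ Polynomial.degreeLT ℝ n, ∀ t, u j t = p.eval t)
    (h : ∀ t, Tendsto (fun j => u j t) atTop (𝓝 (g t))) :
    ∃ p ∈ Polynomial.degreeLT ℝ n, ∀ t, g t = p.eval t := by
  -- A finite-dimensional subspace is closed even in the product topology of `ℝ → ℝ`.
  let e : Polynomial ℝ →ₗ[ℝ] (ℝ → ℝ) := LinearMap.pi Polynomial.leval
  have : FiniteDimensional ℝ (Polynomial.degreeLT ℝ n) :=
    (Polynomial.degreeLTEquiv ℝ n).symm.finiteDimensional
  have hcl := ((Polynomial.degreeLT ℝ n).map e).closed_of_finiteDimensional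
  obtain ⟨p, hp, hpg⟩ := hcl.mem_of_tendsto (tendsto_pi_nhds.mpr h) (Eventually.of_forall fun j =>
    let ⟨p, hp, hpu⟩ := hu j
    ⟨p, hp, funext fun t => (hpu t).symm⟩)
  exact ⟨p, hp, fun t => (congrFun hpg t).symm⟩

/-- Averaging over an interval gains one derivative. -/
lemma ContDiff.integral_comp_add_mul {n : ℕ} {g : ℝ → ℝ} (hg : ContDiff ℝ n g) {d : ℝ}
    (hd : d ≠ 0) : ContDiff ℝ (n + 1 : ℕ) fun t => ∫ s in (0 : ℝ)..1, g (t + d * s) := by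
  have hG : ContDiff ℝ (n + 1 : ℕ) fun t => ∫ s in (0 : ℝ)..t, g s := by
    have hder : ∀ t, HasDerivAt (fun t => ∫ s in (0 : ℝ)..t, g s) (g t) t := fun t =>
      intervalIntegral.integral_hasDerivAt_right (hg.continuous.intervalIntegrable _ _)
        (hg.continuous.stronglyMeasurableAtFilter _ _) hg.continuous.continuousAt
    push_cast
    refine contDiff_succ_iff_deriv.mpr ⟨fun t => (hder t).differentiableAt, by simp, ?_⟩
    rwa [funext fun t => (hder t).deriv]
  have heq : (fun t => ∫ s in (0 : ℝ)..1, g (t + d * s)) =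
      fun t => d⁻¹ * ((∫ s in (0 : ℝ)..(t + d), g s) - ∫ s in (0 : ℝ)..t, g s) := by
    ext t
    rw [intervalIntegral.integral_comp_add_mul _ hd, smul_eq_mul,
      intervalIntegral.integral_interval_sub_left (hg.continuous.intervalIntegrable _ _)
        (hg.continuous.intervalIntegrable _ _)]
    simp
  rw [heq]
  exact contDiff_const.mul ((hG.comp (contDiff_id.add contDiff_const)).sub hG)

/-- A closed subspace of `C(ℝ)` that is stable under affine substitutions and contains a function
that is not a polynomial contains all monomials. -/
lemma Submodule.pow_mem_of_not_polynomial {S : Submodule ℝ C(ℝ, ℝ)}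
    (hS : IsClosed (S : Set C(ℝ, ℝ)))
    (hinv : ∀ g ∈ S, ∀ (w b : ℝ) (F : C(ℝ, ℝ)), (∀ t, F t = g (w * t + b)) → F ∈ S)
    {σ : C(ℝ, ℝ)} (hσS : σ ∈ S) (hσ : ¬ ∃ p : Polynomial ℝ, ∀ t, σ t = p.eval t) (n : ℕ)
    {F : C(ℝ, ℝ)} (hF : ∀ t, F t = t ^ n) : F ∈ S := by
  by_contra hn
  -- `k` counts the missing derivatives. The degree bound `n` does not depend on `k`, which allows
  -- passing to limits; `k = n` covers every continuous `g`.
  have claim : ∀ k ≤ n, ∀ g ∈ S, ContDiff ℝ (n - k : ℕ) g →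
      ∃ p ∈ Polynomial.degreeLT ℝ n, ∀ t, g t = p.eval t := by
    intro k
    induction k with
    | zero =>
      intro _ g hg hgd
      refine exists_polynomial_of_iteratedDeriv_eq_zero hgd fun b => ?_
      by_contra hb
      refine hn ?_
      -- At `w = 0` the `n`-th derivative in `w` is the monomial `t ^ n` times a constant.
      have hmem : iteratedDeriv n g b • F ∈ S :=
        S.pow_mul_iteratedDeriv_mem hS hgd (hinv g hg) n le_rfl 0 b _ fun t => by
          simp [hF, mul_comm]
      exact (S.smul_mem_iff hb).mp hmem
    | succ k ih =>
      intro hk g hg hgd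
      -- An average of translates of `g`: it stays in `S`, is one degree smoother for `d ≠ 0`, and
      -- tends to `g` as `d → 0`.
      let A : ℝ → C(ℝ, ℝ) := fun d =>
        ⟨fun t => ∫ s in (0 : ℝ)..1, g (t + d * s), by fun_prop⟩
      have hA : ∀ d, A d ∈ S := fun d =>
        S.mem_of_eq_integral hS ⟨fun p => g (p.2 + d * p.1), by fun_prop⟩
          (fun s => hinv g hg 1 (d * s) _ fun t => by simp) fun t => rfl
      refine exists_polynomial_of_tendsto (u := fun j : ℕ => A (1 / ((j : ℝ) + 1)))
        (fun j => ih (by omega) _ (hA _) ?_) fun t => ?_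
      · have := hgd.integral_comp_add_mul (d := 1 / ((j : ℝ) + 1)) (by positivity)
        rwa [show n - (k + 1) + 1 = n - k by omega] at this
      · have hc : Continuous fun d => A d t := by
          change Continuous fun d => ∫ s in (0 : ℝ)..1, g (t + d * s)
          fun_prop
        have h0 : A 0 t = g t := by simp [A]
        rw [← h0]
        exact (hc.tendsto 0).comp tendsto_one_div_add_atTop_nhds_zero_nat
  obtain ⟨p, -, hp⟩ := claim n le_rfl σ hσS (by
    simpa using contDiff_zero (𝕜 := ℝ).mpr σ.continuous)
  exact hσ ⟨p, hp⟩

lemma Submodule.eq_top_of_not_polynomial {S : Submodule ℝ C(ℝ, ℝ)}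
    (hS : IsClosed (S : Set C(ℝ, ℝ)))
    (hinv : ∀ g ∈ S, ∀ (w b : ℝ) (F : C(ℝ, ℝ)), (∀ t, F t = g (w * t + b)) → F ∈ S)
    {σ : C(ℝ, ℝ)} (hσS : σ ∈ S) (hσ : ¬ ∃ p : Polynomial ℝ, ∀ t, σ t = p.eval t) : S = ⊤ := by
  let e : Polynomial ℝ →ₐ[ℝ] C(ℝ, ℝ) := Polynomial.toContinuousMapAlgHom
  have hsep : e.range.SeparatesPoints := fun x y hxy =>
    ⟨e Polynomial.X, ⟨_, ⟨Polynomial.X, rfl⟩, rfl⟩, by simpa [e] using hxy⟩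
  have hle : (e.range : Set C(ℝ, ℝ)) ⊆ S := by
    rintro _ ⟨p, rfl⟩
    induction p using Polynomial.induction_on' with
    | add p q hp hq => rw [map_add]; exact S.add_mem hp hq
    | monomial n a =>
      rw [← mul_one a, ← smul_eq_mul, ← Polynomial.smul_monomial]
      change e (a • _) ∈ S
      rw [map_smul]
      exact S.smul_mem _ (S.pow_mem_of_not_polynomial hS hinv hσS hσ n fun t => by simp [e])
  rw [eq_top_iff]
  rintro f -
  exact hS.closure_subset_iff.mpr hle (hsep.closure_eq_univ ▸ Set.mem_univ f)

/-! ### Density of ridge functions -/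

/-- Density of ridge functions with a fixed continuous non-polynomial profile. -/
theorem dense_span_ridge {σ : ℝ → ℝ} (hσ : Continuous σ)
    (hσ_poly : ¬ ∃ p : Polynomial ℝ, ∀ t, σ t = p.eval t) {m : ℕ}
    {T : Submodule ℝ C(Fin m → ℝ, ℝ)} (hT : IsClosed (T : Set C(Fin m → ℝ, ℝ)))
    (h : ∀ (a : Fin m → ℝ) (b : ℝ) (F : C(Fin m → ℝ, ℝ)),
      (∀ z, F z = σ (∑ i, a i * z i + b)) → F ∈ T) : T = ⊤ := by
  let E : (Fin m → ℝ) → C(Fin m → ℝ, ℝ) := fun a => ⟨fun z => Real.exp (∑ i, a i * z i), by fun_prop⟩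
  have hE : ∀ a, E a ∈ T := by
    intro a
    -- The profiles whose ridge functions in direction `a` all lie in `T`; quantifying over `w` and
    -- `b` makes `S` affine-invariant.
    let S : Submodule ℝ C(ℝ, ℝ) := ⨅ (w : ℝ) (b : ℝ), T.comap
      (ContinuousMap.compRightAlgHom ℝ ℝ (⟨fun z => w * (∑ i, a i * z i) + b, by fun_prop⟩ :
        C(Fin m → ℝ, ℝ))).toLinearMap
    have hmem : ∀ g, g ∈ S ↔ ∀ w b : ℝ, g.comp (⟨fun z => w * (∑ i, a i * z i) + b, by fun_prop⟩ :
        C(Fin m → ℝ, ℝ)) ∈ T := fun g => by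
      simp only [S, Submodule.mem_iInf, Submodule.mem_comap]; rfl
    have hS : IsClosed (S : Set C(ℝ, ℝ)) := by
      simp only [S, Submodule.coe_iInf]
      exact isClosed_iInter fun w => isClosed_iInter fun b =>
        hT.preimage (ContinuousMap.continuous_precomp _)
    have htop : S = ⊤ := by
      refine S.eq_top_of_not_polynomial hS (fun g hg w b F hF => ?_) (σ := ⟨σ, hσ⟩) ?_ hσ_poly
      · rw [hmem] at hg ⊢
        intro w' b'
        convert hg (w * w') (w * b' + b) using 1
        ext z
        simp only [ContinuousMap.comp_apply, ContinuousMap.coe_mk, hF]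
        congr 1
        ring
      · rw [hmem]
        intro w b
        refine h (fun i => w * a i) b _ fun z => ?_
        simp only [ContinuousMap.comp_apply, ContinuousMap.coe_mk, Finset.mul_sum, mul_assoc]
    have hexp := (hmem ⟨Real.exp, Real.continuous_exp⟩).mp (htop ▸ Submodule.mem_top) 1 0
    convert hexp using 1
    ext z
    simp [E]
  -- Exponentials are closed under products, so their span is already an algebra and
  -- Stone–Weierstrass applies.
  let P : Submonoid C(Fin m → ℝ, ℝ) :=
    { carrier := Set.range E
      one_mem' := ⟨0, by ext z; simp [E]⟩
      mul_mem' := by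
        rintro _ _ ⟨a, rfl⟩ ⟨b, rfl⟩
        exact ⟨a + b, by ext z; simp [E, add_mul, Finset.sum_add_distrib, Real.exp_add]⟩ }
  have hsep : (Algebra.adjoin ℝ (P : Set C(Fin m → ℝ, ℝ))).SeparatesPoints := by
    intro x y hxy
    obtain ⟨i, hi⟩ := Function.ne_iff.mp hxy
    exact ⟨_, ⟨E (Pi.single i 1), Algebra.subset_adjoin ⟨_, rfl⟩, rfl⟩, by
      simpa [E, Pi.single_apply] using hi⟩
  have hle : (Algebra.adjoin ℝ (P : Set C(Fin m → ℝ, ℝ)) : Set C(Fin m → ℝ, ℝ)) ⊆ T := by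
    intro f hf
    have hspan : f ∈ Submodule.span ℝ (P : Set C(Fin m → ℝ, ℝ)) := by
      have := hf
      rw [SetLike.mem_coe, ← Subalgebra.mem_toSubmodule, Algebra.adjoin_eq_span,
        Submonoid.closure_eq] at this
      exact this
    refine Submodule.span_le.mpr ?_ hspan
    rintro _ ⟨a, rfl⟩
    exact hE a
  rw [eq_top_iff]
  rintro f -
  exact hT.closure_subset_iff.mpr hle (hsep.closure_eq_univ ▸ Set.mem_univ f)
namespace InvNet

/-! ### Layer spaces -/

section layers

variable {G V W : Type*} [Group G] [AddCommGroup V] [Module ℝ V] [AddCommGroup W] [Module ℝ W]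
  {ρ : Representation ℝ G V} {τ : Representation ℝ G W} {M : Submodule ℝ (V →ᵃ[ℝ] W)}

lemma _root_.AffineMap.linear_eq_of_forall_eq_add {f : V →ᵃ[ℝ] W} {φ : V →ₗ[ℝ] W} {w : W}
    (h : ∀ v, f v = φ v + w) : f.linear = φ := by
  ext v
  have := congrFun f.decomp' v
  simp only [Pi.sub_apply] at this
  rw [this, h, h]
  simp

/-- The decomposition `φ v + w` is unique, with `φ = f.linear` and `w = f 0`, so the auxiliary `L`
can be forgotten. -/
lemma IsLayerSpace.mem_iff (hM : IsLayerSpace ρ τ M) (f : V →ᵃ[ℝ] W) :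
    f ∈ M ↔ f.linear ∈ linearPart M ∧ f 0 ∈ τ.invariants := by
  obtain ⟨L, -, hL⟩ := hM
  constructor
  · intro hf
    refine ⟨⟨f, hf, rfl⟩, ?_⟩
    obtain ⟨φ, -, w, hw, h⟩ := (hL f).mp hf
    rw [h]
    simpa using hw
  · rintro ⟨hf, hw⟩
    obtain ⟨f', hf', h'⟩ := (mem_linearPart M _).mp hf
    obtain ⟨φ, hφ, w, -, h⟩ := (hL f').mp hf'
    refine (hL f).mpr ⟨φ, hφ, f 0, hw, fun v => ?_⟩
    rw [← AffineMap.linear_eq_of_forall_eq_add h, h']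
    exact congrFun f.decomp v

lemma IsLayerSpace.map_apply (hM : IsLayerSpace ρ τ M) {φ : V →ₗ[ℝ] W} (hφ : φ ∈ linearPart M)
    (g : G) (v : V) : φ (ρ g v) = τ g (φ v) := by
  obtain ⟨L, hLG, hL⟩ := hM
  obtain ⟨f, hf, rfl⟩ := (mem_linearPart M _).mp hφ
  obtain ⟨φ, hφ, w, -, h⟩ := (hL f).mp hf
  rw [AffineMap.linear_eq_of_forall_eq_add h]
  exact hLG φ hφ g v

lemma IsLayerSpace.add_const_mem (hM : IsLayerSpace ρ τ M) {φ : V →ₗ[ℝ] W}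
    (hφ : φ ∈ linearPart M) {w : W} (hw : w ∈ τ.invariants) :
    φ.toAffineMap + AffineMap.const ℝ V w ∈ M :=
  (hM.mem_iff _).mpr ⟨by simpa using hφ, by simpa using hw⟩

end layers

/-! ### Orbits and invariant forms -/

section orbits

variable {G Y : Type*} [Group G] [MulAction G Y]

lemma mem_orbit_iff_mk_eq {i y : Y} : i ∈ MulAction.orbit G y ↔
    (Quotient.mk _ i : MulAction.orbitRel.Quotient G Y) = Quotient.mk _ y := by
  rw [Quotient.eq, MulAction.orbitRel_apply]

/-- An invariant linear form on `ℝ^Y` is a weighted sum with weights constant on the orbits. -/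
lemma exists_weights_of_invariant [Fintype Y] {ψ : (Y → ℝ) →ₗ[ℝ] ℝ}
    (hψ : ∀ g v, ψ (permRep G Y g v) = ψ v) :
    ∃ d : MulAction.orbitRel.Quotient G Y → ℝ, ∀ v, ψ v = ∑ i, d (Quotient.mk _ i) * v i := by
  classical
  have hinv : (fun y => ψ (Pi.single y 1)) ∈ (permRep G Y).invariants := by
    rw [Representation.mem_invariants]
    intro g
    ext y
    rw [permRep_apply, ← permRep_single, hψ]
  obtain ⟨d, hd⟩ := (mem_invariants_permRep _).mp hinv
  refine ⟨d, fun v => ?_⟩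
  rw [LinearMap.pi_apply_eq_sum_univ ψ v]
  refine Finset.sum_congr rfl fun i _ => ?_
  rw [← hd, smul_eq_mul, mul_comm]
  congr 2
  ext j
  simp [Pi.single_apply, eq_comm]

end orbits

/-! ### The space of networks -/

section networks

variable {V Y : Type*} [AddCommGroup V] [Module ℝ V]

/-- The activation acts separately on the `h` blocks, so a wide network is a sum of `h` independent
networks of width one. -/
lemma mem_neuralSpace_widen {Z : Type*} [AddCommGroup Z] [Module ℝ Z] {σ : ℝ → ℝ}
    {M : Submodule ℝ (V →ᵃ[ℝ] (Y → ℝ))} {N : Submodule ℝ ((Y → ℝ) →ᵃ[ℝ] Z)} {h : ℕ} {F : V → Z} :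
    F ∈ neuralSpace σ (widen M h) (cowiden N h) ↔
      ∃ f : Fin h → (V →ᵃ[ℝ] (Y → ℝ)), ∃ g : Fin h → ((Y → ℝ) →ᵃ[ℝ] Z),
        (∀ k, f k ∈ M) ∧ (∀ k, g k ∈ N) ∧ ∀ x, F x = ∑ k, g k (pointwise σ (f k x)) := by
  constructor
  · rintro ⟨η, ⟨f, hf, hη⟩, β, ⟨g, hg, hβ⟩, rfl⟩
    refine ⟨f, g, hf, hg, fun x => ?_⟩
    simp only [hβ, pointwise, hη]
    rfl
  · rintro ⟨f, g, hf, hg, hF⟩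
    let η : V →ᵃ[ℝ] (Fin h × Y → ℝ) :=
      { toFun := fun x p => f p.1 x p.2
        linear := LinearMap.pi fun p => LinearMap.proj p.2 ∘ₗ (f p.1).linear
        map_vadd' := fun x v => by
          ext p
          exact congrFun ((f p.1).map_vadd x v) p.2 }
    let β : (Fin h × Y → ℝ) →ᵃ[ℝ] Z :=
      { toFun := fun v => ∑ k, g k fun y => v (k, y)
        linear := ∑ k, (g k).linear ∘ₗ LinearMap.funLeft ℝ ℝ fun y => (k, y)
        map_vadd' := fun v w => by
          simp only [LinearMap.sum_apply, LinearMap.comp_apply, vadd_eq_add,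
            ← Finset.sum_add_distrib]
          exact Finset.sum_congr rfl fun k _ =>
            (g k).map_vadd (fun y => v (k, y)) fun y => w (k, y) }
    refine ⟨η, ⟨f, hf, fun _ _ _ => rfl⟩, β, ⟨g, hg, fun _ => rfl⟩, funext fun x => ?_⟩
    rw [hF]
    rfl

variable [TopologicalSpace V]

/-- The continuous networks of arbitrary width form a linear space. -/
def networks (σ : ℝ → ℝ) (M : Submodule ℝ (V →ᵃ[ℝ] (Y → ℝ)))
    (N : Submodule ℝ ((Y → ℝ) →ᵃ[ℝ] ℝ)) : Submodule ℝ C(V, ℝ) where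
  carrier := {F | ∃ h : ℕ, ⇑F ∈ neuralSpace σ (widen M h) (cowiden N h)}
  zero_mem' := ⟨0, mem_neuralSpace_widen.mpr
    ⟨fun _ => 0, fun _ => 0, fun k => k.elim0, fun k => k.elim0, fun x => by simp⟩⟩
  add_mem' := by
    rintro F₁ F₂ ⟨h₁, H₁⟩ ⟨h₂, H₂⟩
    obtain ⟨f₁, g₁, hf₁, hg₁, hF₁⟩ := mem_neuralSpace_widen.mp H₁
    obtain ⟨f₂, g₂, hf₂, hg₂, hF₂⟩ := mem_neuralSpace_widen.mp H₂
    -- Networks are added by placing their channels side by side.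
    refine ⟨h₁ + h₂, mem_neuralSpace_widen.mpr ⟨Fin.append f₁ f₂, Fin.append g₁ g₂,
      fun k => ?_, fun k => ?_, fun x => ?_⟩⟩
    · induction k using Fin.addCases <;> simp [hf₁, hf₂]
    · induction k using Fin.addCases <;> simp [hg₁, hg₂]
    · simp [Fin.sum_univ_add, hF₁, hF₂]
  smul_mem' := by
    rintro c F ⟨h, H⟩
    obtain ⟨f, g, hf, hg, hF⟩ := mem_neuralSpace_widen.mp H
    exact ⟨h, mem_neuralSpace_widen.mpr ⟨f, fun k => c • g k, hf,
      fun k => N.smul_mem c (hg k), fun x => by simp [hF, Finset.mul_sum]⟩⟩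

lemma mem_networks_of_eq {σ : ℝ → ℝ} {M : Submodule ℝ (V →ᵃ[ℝ] (Y → ℝ))}
    {N : Submodule ℝ ((Y → ℝ) →ᵃ[ℝ] ℝ)} {f : V →ᵃ[ℝ] (Y → ℝ)} (hf : f ∈ M)
    {g : (Y → ℝ) →ᵃ[ℝ] ℝ} (hg : g ∈ N) {F : C(V, ℝ)}
    (hF : ∀ x, F x = g (pointwise σ (f x))) : F ∈ networks σ M N :=
  ⟨1, mem_neuralSpace_widen.mpr
    ⟨fun _ => f, fun _ => g, fun _ => hf, fun _ => hg, fun x => by simp [hF]⟩⟩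

end networks

/-! ### Merging orbitwise outer functions -/

section superpositions

variable {G V Y : Type*} [Group G] [AddCommGroup V] [Module ℝ V] [TopologicalSpace V] [Fintype Y]
  [MulAction G Y] {m : ℕ}

lemma sum_apply_mem_symmetricSuperpositions {φ : Y → (V →ₗ[ℝ] (Fin m → ℝ))} {ι : Type*}
    (s : Finset ι) {F : ι → C(V, ℝ)} (hF : ∀ k ∈ s, F k ∈ symmetricSuperpositions φ) :
    ∑ k ∈ s, F k ∈ symmetricSuperpositions φ := by
  classical
  induction s using Finset.induction_on with
  | empty => exact ⟨0, fun x => by simp⟩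
  | insert k s hk ih =>
    obtain ⟨f₁, h₁⟩ := hF k (Finset.mem_insert_self k s)
    obtain ⟨f₂, h₂⟩ := ih fun j hj => hF j (Finset.mem_insert_of_mem hj)
    rw [Finset.sum_insert hk]
    exact ⟨f₁ + f₂, fun x => by simp [h₁, h₂, Finset.sum_add_distrib]⟩

/-- If the coordinates of different orbits can be separated linearly, a superposition whose outer
function depends on the orbit is a superposition with a single outer function. -/
lemma mem_symmetricSuperpositions_of_orbitwise [Nonempty Y] {φ : Y → (V →ₗ[ℝ] (Fin m → ℝ))}
    {P : MulAction.orbitRel.Quotient G Y → ((Fin m → ℝ) →ₗ[ℝ] (Fin m → ℝ))}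
    (hP : ∀ i x, P (Quotient.mk _ i) (φ i x) = φ i x)
    (hP' : ∀ o i x, o ≠ Quotient.mk _ i → P o (φ i x) = 0)
    (H : MulAction.orbitRel.Quotient G Y → C(Fin m → ℝ, ℝ)) {F : C(V, ℝ)}
    (hF : ∀ x, F x = ∑ i, H (Quotient.mk _ i) (φ i x)) : F ∈ symmetricSuperpositions φ := by
  classical
  have : Fintype (MulAction.orbitRel.Quotient G Y) := Fintype.ofFinite _
  -- At `φ i x` the foreign orbits contribute `H o 0`, which is subtracted below. This also removes
  -- the own orbit's `H o 0`; `C` restores the total, spread evenly over `Y`.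
  let C : ℝ := (∑ i : Y, H (Quotient.mk _ i) 0) / Fintype.card Y
  refine ⟨⟨fun z => ∑ o, (H o (P o z) - H o 0) + C, ?_⟩, fun x => ?_⟩
  · have : ∀ o, Continuous (P o) := fun o => (P o).continuous_of_finiteDimensional
    fun_prop
  · have key : ∀ i, ∑ o, (H o (P o (φ i x)) - H o 0) =
        H (Quotient.mk _ i) (φ i x) - H (Quotient.mk _ i) 0 := fun i => by
      rw [Finset.sum_eq_single (Quotient.mk _ i : MulAction.orbitRel.Quotient G Y), hP]
      · intro o _ ho
        rw [hP' o i x ho, sub_self]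
      · simp
    simp only [ContinuousMap.coe_mk, key]
    rw [Finset.sum_add_distrib, Finset.sum_sub_distrib, Finset.sum_const, Finset.card_univ,
      nsmul_eq_mul, hF, mul_div_cancel₀ _ (by exact_mod_cast Fintype.card_ne_zero)]
    ring

end superpositions

/-! ### The two inclusions -/

section main

variable {G X Y : Type*} [Group G] [MulAction G Y]
  {σ : ℝ → ℝ} {M : Submodule ℝ ((X → ℝ) →ᵃ[ℝ] (Y → ℝ))} {N : Submodule ℝ ((Y → ℝ) →ᵃ[ℝ] ℝ)}
  {m : ℕ}

/-- The coefficients do not depend on `i`: one linear form on `ℝ^m` computes every coordinate of `ξ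
x`. -/
lemma basis_repr_sum_apply (φ : Module.Basis (Fin m) ℝ (linearPart M)) (ξ : linearPart M)
    (x : X → ℝ) (i : Y) :
    (ξ : (X → ℝ) →ₗ[ℝ] (Y → ℝ)) x i =
      ∑ t, φ.repr ξ t * basisMap (fun t => (φ t : (X → ℝ) →ₗ[ℝ] (Y → ℝ))) i x t := by
  have h := congrArg (fun ζ : linearPart M => (ζ : (X → ℝ) →ₗ[ℝ] (Y → ℝ)) x i) (φ.sum_repr ξ)
  rw [← h]
  simp [basisMap, LinearMap.sum_apply, Finset.sum_apply, -Module.Basis.sum_repr]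

/-- The orbit projections of the linear part of `M`, read in the values of the basis maps. -/
lemma exists_orbit_separation
    (hM_orbit : ∀ φ ∈ linearPart M, ∀ y : Y, orbitProj G y ∘ₗ φ ∈ linearPart M)
    (φ : Module.Basis (Fin m) ℝ (linearPart M)) :
    ∃ P : MulAction.orbitRel.Quotient G Y → ((Fin m → ℝ) →ₗ[ℝ] (Fin m → ℝ)),
      (∀ i x, P (Quotient.mk _ i) (basisMap (fun t => (φ t : (X → ℝ) →ₗ[ℝ] (Y → ℝ))) i x) =
        basisMap (fun t => (φ t : (X → ℝ) →ₗ[ℝ] (Y → ℝ))) i x) ∧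
      ∀ o i x, o ≠ Quotient.mk _ i →
        P o (basisMap (fun t => (φ t : (X → ℝ) →ₗ[ℝ] (Y → ℝ))) i x) = 0 := by
  classical
  let ξ : MulAction.orbitRel.Quotient G Y → Fin m → linearPart M := fun o t =>
    ⟨orbitProj G o.out ∘ₗ (φ t : (X → ℝ) →ₗ[ℝ] (Y → ℝ)), hM_orbit _ (φ t).2 _⟩
  -- Row `t` holds the basis coordinates of the projection of `φ t` to the orbit `o`.
  let P : MulAction.orbitRel.Quotient G Y → ((Fin m → ℝ) →ₗ[ℝ] (Fin m → ℝ)) := fun o =>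
    Matrix.toLin' (Matrix.of fun t s => φ.repr (ξ o t) s)
  have hP : ∀ o i x t, P o (basisMap (fun t => (φ t : (X → ℝ) →ₗ[ℝ] (Y → ℝ))) i x) t =
      (MulAction.orbit G o.out).indicator ((φ t : (X → ℝ) →ₗ[ℝ] (Y → ℝ)) x) i := by
    intro o i x t
    refine Eq.trans ?_ (basis_repr_sum_apply φ (ξ o t) x i).symm
    simp [P, Matrix.toLin'_apply, Matrix.mulVec, dotProduct]
  refine ⟨P, fun i x => ?_, fun o i x ho => ?_⟩
  · ext t
    rw [hP, Set.indicator_of_mem]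
    · rfl
    · rw [mem_orbit_iff_mk_eq, Quotient.out_eq]
  · ext t
    rw [hP, Set.indicator_of_notMem]
    · rfl
    · rw [mem_orbit_iff_mk_eq, Quotient.out_eq]
      exact ho.symm

lemma networks_subset_symmetricSuperpositions [Fintype X] [Fintype Y]
    [MulAction G X] [Nonempty Y]
    (hσ : Continuous σ)
    (hM : IsLayerSpace (permRep G X) (permRep G Y) M)
    (hM_orbit : ∀ φ ∈ linearPart M, ∀ y : Y, orbitProj G y ∘ₗ φ ∈ linearPart M)
    (hN : IsLayerSpace (permRep G Y) (Representation.trivial ℝ G ℝ) N)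
    (φ : Module.Basis (Fin m) ℝ (linearPart M)) :
    (networks σ M N : Set C(X → ℝ, ℝ)) ⊆
      symmetricSuperpositions (basisMap fun t => (φ t : (X → ℝ) →ₗ[ℝ] (Y → ℝ))) := by
  rintro F ⟨h, hF⟩
  obtain ⟨f, g, hf, hg, hF⟩ := mem_neuralSpace_widen.mp hF
  obtain ⟨P, hP, hP'⟩ := exists_orbit_separation hM_orbit φ
  have hgc : ∀ k, Continuous (g k) := fun k => (g k).continuous_of_finiteDimensional
  have hfc : ∀ k, Continuous (f k) := fun k => (f k).continuous_of_finiteDimensional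
  have hpc : Continuous (pointwise (I := Y) σ) :=
    continuous_pi fun i => hσ.comp (continuous_apply i)
  have hFsum : F = ∑ k, (⟨fun x => g k (pointwise σ (f k x)),
      (hgc k).comp (hpc.comp (hfc k))⟩ : C(X → ℝ, ℝ)) := by
    ext x
    simp [hF]
  rw [hFsum]
  refine sum_apply_mem_symmetricSuperpositions _ fun k _ => ?_
  obtain ⟨hfl, hf0⟩ := (hM.mem_iff _).mp (hf k)
  obtain ⟨hgl, -⟩ := (hN.mem_iff _).mp (hg k)
  obtain ⟨w, hw⟩ := (mem_invariants_permRep _).mp hf0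
  obtain ⟨d, hd⟩ := exists_weights_of_invariant fun γ v => hN.map_apply hgl γ v
  -- The output bias is shared equally among the `i : Y`.
  let c : ℝ := g k 0 / Fintype.card Y
  refine mem_symmetricSuperpositions_of_orbitwise hP hP' (fun o =>
    ⟨fun z => d o * σ (∑ t, φ.repr ⟨_, hfl⟩ t * z t + w o) + c, by fun_prop⟩) fun x => ?_
  have h1 : ∀ i, f k x i = ∑ t, φ.repr ⟨_, hfl⟩ t *
      basisMap (fun t => (φ t : (X → ℝ) →ₗ[ℝ] (Y → ℝ))) i x t + w (Quotient.mk _ i) := fun i => by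
    rw [← basis_repr_sum_apply, ← hw]
    exact congrFun (congrFun (f k).decomp x) i
  have h2 : ∀ v, g k v = ∑ i, d (Quotient.mk _ i) * v i + g k 0 := fun v => by
    rw [← hd]
    exact congrFun (g k).decomp v
  simp only [ContinuousMap.coe_mk, ← h1, Finset.sum_add_distrib, Finset.sum_const,
    Finset.card_univ, nsmul_eq_mul, c]
  rw [h2, mul_div_cancel₀ _ (by exact_mod_cast Fintype.card_ne_zero)]
  rfl

/-- The sum of the units of one orbit is a network. -/
lemma sum_orbit_mem_networks [Fintype Y] [MulAction G X]
    (hM : IsLayerSpace (permRep G X) (permRep G Y) M)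
    (hM_orbit : ∀ φ ∈ linearPart M, ∀ y : Y, orbitProj G y ∘ₗ φ ∈ linearPart M)
    (hN : IsLayerSpace (permRep G Y) (Representation.trivial ℝ G ℝ) N)
    (hN_orbit : ∀ y : Y, ∃ ψ ∈ linearPart N, ψ ((MulAction.orbit G y).indicator 1) ≠ 0)
    {ξ : (X → ℝ) →ₗ[ℝ] (Y → ℝ)} (hξ : ξ ∈ linearPart M) (b : ℝ) (y : Y) {F : C(X → ℝ, ℝ)}
    (hF : ∀ x, F x = ∑ i, (MulAction.orbit G y).indicator (fun i => σ (ξ x i + b)) i) :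
    F ∈ networks σ M N := by
  classical
  obtain ⟨ψ, hψN, hψ⟩ := hN_orbit y
  obtain ⟨d, hd⟩ := exists_weights_of_invariant fun γ v => hN.map_apply hψN γ v
  -- On the indicator of the orbit, `ψ` is this weight times the size of the orbit.
  have hd0 : d (Quotient.mk _ y) ≠ 0 := by
    intro h0
    refine hψ ?_
    rw [hd]
    refine Finset.sum_eq_zero fun i _ => ?_
    by_cases hi : i ∈ MulAction.orbit G y
    · rw [mem_orbit_iff_mk_eq.mp hi, h0, zero_mul]
    · rw [Set.indicator_of_notMem hi, mul_zero]
  -- Units outside the orbit lose their linear part but keep the bias `b`; their constant total `c`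
  -- is cancelled by the output bias `-c`.
  let c : ℝ := ∑ i, (MulAction.orbit G y)ᶜ.indicator (fun i => d (Quotient.mk _ i) * σ b) i
  have hf := hM.add_const_mem (hM_orbit ξ hξ y) (w := fun _ => b)
    ((mem_invariants_permRep _).mpr ⟨fun _ => b, fun _ => rfl⟩)
  have hg := hN.add_const_mem hψN (w := -c) (by simp [Representation.mem_invariants])
  refine mem_networks_of_eq hf (N.smul_mem (d (Quotient.mk _ y))⁻¹ hg) fun x => ?_
  have key : ψ (pointwise σ ((orbitProj G y ∘ₗ ξ) x + fun _ => b)) =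
      d (Quotient.mk _ y) * F x + c := by
    rw [hd, hF, Finset.mul_sum, ← Finset.sum_add_distrib]
    refine Finset.sum_congr rfl fun i _ => ?_
    by_cases hi : i ∈ MulAction.orbit G y
    · simp [hi, pointwise, orbitProj, mem_orbit_iff_mk_eq.mp hi]
    · simp [hi, pointwise, orbitProj]
  have key' : (d (Quotient.mk _ y))⁻¹ *
      (ψ (pointwise σ ((orbitProj G y ∘ₗ ξ) x + fun _ => b)) + -c) = F x := by
    rw [key, add_neg_cancel_right, inv_mul_cancel_left₀ hd0]
  exact key'.symm

lemma symmetricSuperpositions_subset_closure_networks [Fintype X] [Fintype Y]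
    [MulAction G X] (hσ : Continuous σ)
    (hσ_poly : ¬ ∃ p : Polynomial ℝ, ∀ t, σ t = p.eval t)
    (hM : IsLayerSpace (permRep G X) (permRep G Y) M)
    (hM_orbit : ∀ φ ∈ linearPart M, ∀ y : Y, orbitProj G y ∘ₗ φ ∈ linearPart M)
    (hN : IsLayerSpace (permRep G Y) (Representation.trivial ℝ G ℝ) N)
    (hN_orbit : ∀ y : Y, ∃ ψ ∈ linearPart N, ψ ((MulAction.orbit G y).indicator 1) ≠ 0)
    (φ : Module.Basis (Fin m) ℝ (linearPart M)) :
    symmetricSuperpositions (basisMap fun t => (φ t : (X → ℝ) →ₗ[ℝ] (Y → ℝ))) ⊆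
      closure (networks σ M N : Set C(X → ℝ, ℝ)) := by
  classical
  have : Fintype (MulAction.orbitRel.Quotient G Y) := Fintype.ofFinite _
  let β : Y → C(X → ℝ, Fin m → ℝ) := fun i =>
    ⟨basisMap (fun t => (φ t : (X → ℝ) →ₗ[ℝ] (Y → ℝ))) i,
      LinearMap.continuous_of_finiteDimensional _⟩
  let Φ : C(Fin m → ℝ, ℝ) →ₗ[ℝ] C(X → ℝ, ℝ) :=
    ∑ i, (ContinuousMap.compRightAlgHom ℝ ℝ (β i)).toLinearMap
  have hΦ : ∀ f x, Φ f x = ∑ i, f (β i x) := fun f x => by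
    simp [Φ, LinearMap.sum_apply]
  have hΦc : Continuous Φ := by
    have : ⇑Φ = fun f => ∑ i, f.comp (β i) := by
      ext f x
      rw [hΦ, ContinuousMap.sum_apply]
      rfl
    rw [this]
    exact continuous_finsetSum _ fun i _ =>
      ContinuousMap.continuous_precomp (Z := ℝ) (β i)
  -- The preimage under the continuous linear `Φ` is a closed subspace, so ridge functions suffice.
  have htop : (networks σ M N).topologicalClosure.comap Φ = ⊤ := by
    refine dense_span_ridge hσ hσ_poly
      ((networks σ M N).isClosed_topologicalClosure.preimage hΦc) fun a b f hf => ?_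
    refine (networks σ M N).le_topologicalClosure ?_
    let ξ : linearPart M := ∑ t, a t • φ t
    have hξ : ∀ x i, (ξ : (X → ℝ) →ₗ[ℝ] (Y → ℝ)) x i = ∑ t, a t * β i x t := fun x i => by
      simp [ξ, β, basisMap, LinearMap.sum_apply, Finset.sum_apply]
    have hξc : Continuous (ξ : (X → ℝ) →ₗ[ℝ] (Y → ℝ)) :=
      LinearMap.continuous_of_finiteDimensional _
    let F : MulAction.orbitRel.Quotient G Y → C(X → ℝ, ℝ) := fun o =>
      ⟨fun x => ∑ i, (MulAction.orbit G o.out).indicator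
        (fun i => σ ((ξ : (X → ℝ) →ₗ[ℝ] (Y → ℝ)) x i + b)) i, by
        simp only [Set.indicator_apply]
        refine continuous_finsetSum _ fun i _ => ?_
        split_ifs <;> fun_prop⟩
    -- Every `i` lies in exactly one orbit.
    have hsum : Φ f = ∑ o, F o := by
      ext x
      rw [hΦ, ContinuousMap.sum_apply]
      simp only [F, ContinuousMap.coe_mk]
      rw [Finset.sum_comm]
      refine Finset.sum_congr rfl fun i _ => ?_
      rw [Finset.sum_eq_single (Quotient.mk _ i : MulAction.orbitRel.Quotient G Y)]
      · rw [Set.indicator_of_mem (by rw [mem_orbit_iff_mk_eq, Quotient.out_eq]), hf, hξ]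
      · intro o _ ho
        refine Set.indicator_of_notMem ?_ _
        rw [mem_orbit_iff_mk_eq, Quotient.out_eq]
        exact ho.symm
      · simp
    rw [hsum]
    exact Submodule.sum_mem _ fun o _ =>
      sum_orbit_mem_networks hM hM_orbit hN hN_orbit ξ.2 b o.out fun _ => rfl
  rintro F ⟨f, hf⟩
  have hFf : F = Φ f := by
    ext x
    rw [hΦ, hf]
    rfl
  rw [hFf]
  exact (htop ▸ Submodule.mem_top : f ∈ (networks σ M N).topologicalClosure.comap Φ)

end main

end InvNet

theorem mainTheorem7 {G X Y : Type*} [Group G] [Finite G] [Fintype X] [Fintype Y] [Nonempty Y]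
    [MulAction G X] [MulAction G Y]
    (σ : ℝ → ℝ) (hσ : Continuous σ) (hσ_poly : ¬ ∃ p : Polynomial ℝ, ∀ t, σ t = p.eval t)
    (M : Submodule ℝ ((X → ℝ) →ᵃ[ℝ] (Y → ℝ)))
    (hM : InvNet.IsLayerSpace (InvNet.permRep G X) (InvNet.permRep G Y) M)
    (hM_orbit : ∀ φ ∈ InvNet.linearPart M, ∀ y : Y,
      InvNet.orbitProj G y ∘ₗ φ ∈ InvNet.linearPart M)
    (N : Submodule ℝ ((Y → ℝ) →ᵃ[ℝ] ℝ))
    (hN : InvNet.IsLayerSpace (InvNet.permRep G Y) (Representation.trivial ℝ G ℝ) N)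
    (hN_orbit : ∀ y : Y, ∃ ψ ∈ InvNet.linearPart N, ψ ((MulAction.orbit G y).indicator 1) ≠ 0)
    {m : ℕ} (φ : Module.Basis (Fin m) ℝ (InvNet.linearPart M)) :
    InvNet.universalityClass σ M N =
      closure (InvNet.symmetricSuperpositions
        (InvNet.basisMap fun t => (φ t : (X → ℝ) →ₗ[ℝ] (Y → ℝ)))) := by
  -- The set closed in `universalityClass` is definitionally the carrier of `networks`.
  refine Set.Subset.antisymm (closure_mono ?_) (closure_minimal ?_ isClosed_closure)
  · exact InvNet.networks_subset_symmetricSuperpositions hσ hM hM_orbit hN φ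
  · exact InvNet.symmetricSuperpositions_subset_closure_networks hσ hσ_poly hM hM_orbit hN
      hN_orbit φ
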